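/- Let $T: M_d(\mathbb{C}) \to M_{d'}(\mathbb{C})$ be a quantum channel (a completely positive, trace preserving linear map), let $\tau = (T\otimes \mathrm{id})(|\Omega\rangle\langle\Omega|)$ with $|\Omega\rangle = d^{-1/2}\sum_{i=1}^d |ii\rangle$ be its Choi state, and let $S(\tau) = -\mathrm{Tr}[\tau\log\tau]$ be its von Neumann entropy, where $\log$ is the logarithm to base $2$. Write $\|\cdot\|_1$ for the trace norm (sum of the singular values) and $\|\cdot\|_\infty$ for the operator norm (largest singular value). A unitary $1$-design on a finite-dimensional Hilbert space is a probability measure on the unitary group that gives every polynomial in the entries of $U$ and of $U^\dagger$, of degree at most $1$ in each of the two, the same expectation as the Haar probability measure. A $1$-design on pure states is the law of the pure state (rank-one projection) $U|\phi_0\rangle\langle\phi_0|U^\dagger$, where $\phi_0$ is a fixed unit vector and $U$ is distributed according to a unitary $1$-design. It is called continuous if every single pure state has probability $0$. For a continuous $1$-design $\mu$ on the pure states of $(\mathbb{C}^d)^{\otimes n}$, the average contraction of the trace distance under $T^{\otimes n}$ is $$\eta_1(T^{\otimes n}, \|\cdot\|_1, \mu\times\mu) = \mathbb{E}_{(\rho,\sigma)\sim\mu\times\mu}\left[\frac{\|T^{\otimes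 n}(\rho) - T^{\otimes n}(\sigma)\|_1}{\|\rho-\sigma\|_1}\right].$$ (i) For every $\varepsilon\in(0,1)$ and every $\delta>0$ there is an $N$ such that, for all $n\ge N$ and every continuous $1$-design $\mu$ on the pure states of $(\mathbb{C}^d)^{\otimes n}$, $$\eta_1(T^{\otimes n}, \|\cdot\|_1, \mu\times\mu) \ \ge\ 1 - \varepsilon - \left(2^{S(\tau)+\delta}\,\left\|T(I/d)\right\|_\infty\right)^n .$$ (ii) If $S(\tau) < \log\left(\|T(I/d)\|_\infty^{-1}\right)$, then the average contraction tends to $1$ as $n\to\infty$, uniformly in $\mu$: for every $\varepsilon>0$ there is an $N$ such that $|\eta_1(T^{\otimes n}, \|\cdot\|_1, \mu\times\mu) - 1| < \varepsilon$ for all $n\ge N$ and every continuous $1$-design $\mu$ on the pure states of $(\mathbb{C}^d)^{\otimes n}$. -/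

import Mathlib

open MeasureTheory Matrix
open scoped ComplexOrder

noncomputable section

namespace QInfo

/-! ### Quantum channels -/

section Channels

variable {ι κ : Type*} [Fintype ι] [DecidableEq ι] [Fintype κ] [DecidableEq κ]

/-- The map `T ⊗ id` on matrices over a bipartite system whose second factor has basis `α`:
`T` is applied to each of the blocks labelled by a pair of basis indices of the second factor. -/
def ampliation (T : Matrix ι ι ℂ →ₗ[ℂ] Matrix κ κ ℂ) {α : Type*}
    (X : Matrix (ι × α) (ι × α) ℂ) : Matrix (κ × α) (κ × α) ℂ :=
  Matrix.of fun a b => T (Matrix.of fun i j => X (i, a.2) (j, b.2)) a.1 b.1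

/-- A quantum channel: a completely positive and trace preserving linear map. -/
structure IsQuantumChannel (T : Matrix ι ι ℂ →ₗ[ℂ] Matrix κ κ ℂ) : Prop where
  completely_positive : ∀ (k : ℕ) (X : Matrix (ι × Fin k) (ι × Fin k) ℂ),
    X.PosSemidef → (ampliation T X).PosSemidef
  trace_preserving : ∀ X : Matrix ι ι ℂ, (T X).trace = X.trace

/-- The maximally entangled vector `d^{-1/2} ∑ i, |i i⟩`, with `d` the dimension. -/
def maxEntangled (ι : Type*) [Fintype ι] [DecidableEq ι] : ι × ι → ℂ :=
  fun p => if p.1 = p.2 then ((1 / Real.sqrt (Fintype.card ι) : ℝ) : ℂ) else 0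

/-- The Choi state `(T ⊗ id)(|Ω⟩⟨Ω|)`. -/
def choiState (T : Matrix ι ι ℂ →ₗ[ℂ] Matrix κ κ ℂ) : Matrix (κ × ι) (κ × ι) ℂ :=
  ampliation T (Matrix.vecMulVec (maxEntangled ι) (star (maxEntangled ι)))

/-- The maximally mixed state `I / d`. -/
def maxMixed (ι : Type*) [Fintype ι] [DecidableEq ι] : Matrix ι ι ℂ :=
  ((Fintype.card ι : ℂ)⁻¹) • (1 : Matrix ι ι ℂ)

/-- The tensor power `T^{⊗ n}`. The `n`-fold tensor power of the space with basis `ι` has the basis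
`Fin n → ι`; the matrix unit `|i⟩⟨j|` on it, which is the tensor product of the matrix units
`|i k⟩⟨j k|`, is sent to the tensor product of the matrices `T (|i k⟩⟨j k|)`. -/
def tensorPower (T : Matrix ι ι ℂ →ₗ[ℂ] Matrix κ κ ℂ) (n : ℕ) :
    Matrix (Fin n → ι) (Fin n → ι) ℂ →ₗ[ℂ] Matrix (Fin n → κ) (Fin n → κ) ℂ where
  toFun X := Matrix.of fun a b => ∑ i : Fin n → ι, ∑ j : Fin n → ι,
    X i j * ∏ k, T (Matrix.single (i k) (j k) 1) (a k) (b k)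
  map_add' X Y := by
    ext a b
    simp [add_mul, Finset.sum_add_distrib]
  map_smul' c X := by
    ext a b
    simp [mul_assoc, Finset.mul_sum]

end Channels

/-! ### Norms and entropy -/

section Norms

variable {ι : Type*} [Fintype ι] [DecidableEq ι]

/-- The trace norm: the sum of the singular values of `A`, which are the square roots of the
eigenvalues of `Aᴴ * A`. -/
def traceNorm (A : Matrix ι ι ℂ) : ℝ :=
  ∑ i, Real.sqrt ((Matrix.isHermitian_conjTranspose_mul_self A).eigenvalues i)

/-- The trace distance. -/
def traceDist (ρ σ : Matrix ι ι ℂ) : ℝ := (1 / 2) * traceNorm (ρ - σ)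

/-- The operator norm with respect to the Euclidean norm, that is, the largest singular value. -/
def opNorm (A : Matrix ι ι ℂ) : ℝ :=
  ‖Matrix.toEuclideanCLM (n := ι) (𝕜 := ℂ) A‖

/-- The von Neumann entropy `- Tr (ρ log ρ)`, with the logarithm to base `2`. -/
def vonNeumannEntropy (ρ : Matrix ι ι ℂ) : ℝ :=
  -((ρ * cfc (Real.logb 2) ρ).trace.re)

end Norms

/-! ### Pure states, designs, average contraction -/

section States

variable {ι : Type*} [Fintype ι] [DecidableEq ι]

instance instMeasurableSpaceMatrix : MeasurableSpace (Matrix ι ι ℂ) :=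
  inferInstanceAs (MeasurableSpace (ι → ι → ℂ))

instance instBorelSpaceMatrix : BorelSpace (Matrix ι ι ℂ) :=
  inferInstanceAs (BorelSpace (ι → ι → ℂ))

/-- The pure states: the rank-one projections `|ψ⟩⟨ψ|` of unit vectors `ψ`. -/
abbrev PureState (ι : Type*) [Fintype ι] : Type _ :=
  {ρ : Matrix ι ι ℂ // ∃ ψ : ι → ℂ, star ψ ⬝ᵥ ψ = 1 ∧ ρ = Matrix.vecMulVec ψ (star ψ)}

/-- The pure state `U |φ⟩⟨φ| U†`. -/
def rotate (U : Matrix.unitaryGroup ι ℂ) (φ : PureState ι) : PureState ι :=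
  ⟨(U : Matrix ι ι ℂ) * φ.1 * (U : Matrix ι ι ℂ)ᴴ, by
    obtain ⟨ψ, hψ, h⟩ := φ.2
    refine ⟨(U : Matrix ι ι ℂ) *ᵥ ψ, ?_, ?_⟩
    · have hU : (U : Matrix ι ι ℂ)ᴴ * (U : Matrix ι ι ℂ) = 1 :=
        Matrix.mem_unitaryGroup_iff'.1 U.2
      rw [Matrix.star_mulVec, Matrix.dotProduct_mulVec, Matrix.vecMul_vecMul, hU,
        Matrix.vecMul_one, hψ]
    · rw [h, Matrix.mul_vecMulVec, Matrix.vecMulVec_mul, Matrix.star_mulVec]⟩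

instance instCompactSpaceUnitaryGroup : CompactSpace (Matrix.unitaryGroup ι ℂ) := by
  suffices h : IsCompact (Matrix.unitaryGroup ι ℂ : Set (Matrix ι ι ℂ)) from
    isCompact_iff_compactSpace.1 h
  have hK : IsCompact (Set.univ.pi fun _ : ι => Set.univ.pi fun _ : ι =>
      Metric.closedBall (0 : ℂ) 1) :=
    isCompact_univ_pi fun _ => isCompact_univ_pi fun _ => isCompact_closedBall _ _
  refine IsCompact.of_isClosed_subset (X := Matrix ι ι ℂ) hK ?_ ?_
  · have : (Matrix.unitaryGroup ι ℂ : Set (Matrix ι ι ℂ)) = {A | A * star A = 1} := by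
      ext A
      exact Matrix.mem_unitaryGroup_iff
    rw [this]
    exact isClosed_eq (by fun_prop) continuous_const
  · intro A hA i _ j _
    simpa using entry_norm_bound_of_unitary hA i j

/-- The Haar probability measure on the unitary group. -/
def haarUnitary (ι : Type*) [Fintype ι] [DecidableEq ι] : Measure (Matrix.unitaryGroup ι ℂ) :=
  Measure.haarMeasure ⊤

/-- The value at `U` of a polynomial in the entries of `U` (the variables `Sum.inl (i, j)`) and the
entries of `U†` (the variables `Sum.inr (i, j)`). -/
def evalUnitary (P : MvPolynomial ((ι × ι) ⊕ (ι × ι)) ℂ) (U : Matrix.unitaryGroup ι ℂ) : ℂ :=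
  MvPolynomial.eval (Sum.elim (fun p => (U : Matrix ι ι ℂ) p.1 p.2)
    (fun p => (U : Matrix ι ι ℂ)ᴴ p.1 p.2)) P

/-- A unitary `t`-design: a probability measure on the unitary group with the same expectations as
the Haar measure for all polynomials of degree at most `t` in the entries of `U` and at most `t` in
the entries of `U†`. -/
def IsUnitaryDesign (t : ℕ) (ν : Measure (Matrix.unitaryGroup ι ℂ)) : Prop :=
  IsProbabilityMeasure ν ∧
  ∀ P : MvPolynomial ((ι × ι) ⊕ (ι × ι)) ℂ,
    (∀ m ∈ P.support, ∑ p, m (Sum.inl p) ≤ t ∧ ∑ p, m (Sum.inr p) ≤ t) →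
    ∫ U, evalUnitary P U ∂ν = ∫ U, evalUnitary P U ∂(haarUnitary ι)

/-- A state `t`-design: the law of `U |φ₀⟩` for a fixed reference pure state `φ₀` and a random
unitary `U` distributed according to a unitary `t`-design. -/
def IsStateDesign (t : ℕ) (μ : Measure (PureState ι)) : Prop :=
  ∃ (φ₀ : PureState ι) (ν : Measure (Matrix.unitaryGroup ι ℂ)),
    IsUnitaryDesign t ν ∧ μ = ν.map (fun U => rotate U φ₀)

/-- The average contraction (first moment of contraction) of the trace distance under `Φ`, for pairs
of pure states distributed according to `ν`. -/
def avgContraction {κ : Type*} [Fintype κ] [DecidableEq κ]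
    (Φ : Matrix ι ι ℂ →ₗ[ℂ] Matrix κ κ ℂ) (ν : Measure (PureState ι × PureState ι)) : ℝ :=
  ∫ p, traceDist (Φ p.1.1) (Φ p.2.1) / traceDist p.1.1 p.2.1 ∂ν

end States

end QInfo

end

/-!
For independent `ρ`, `σ` drawn from a continuous design, `ρ ≠ σ` almost surely and the trace
distance of `ρ` and `σ` is at most `1`, so the average contraction is at least the average trace
distance of the outputs (`integral_traceDist_le_avgContraction`). It is at most `1` because positive
trace preserving maps contract the trace norm (`traceNorm_map_le`).

The one-shot lower bound `le_avgContraction` is a distinguishing argument. Let `Φ` have Kraus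
operators `K s`, and let `A` be a finite set of indices. For `ρ = |ψ⟩⟨ψ|`, let `Π` be the projection
on the span of the vectors `K s ψ`, `s ∈ A`; its rank is at most `#A`. The trace distance of `Φ ρ`
and `Φ σ` is at least `Tr Π (Φ ρ) - Tr Π (Φ σ)`. The first term is at least the trace of the part
`∑ s ∈ A, K s ρ (K s)†` of the output. Averaged over `σ`, the second is `Tr Π Φ(I/D)`, since the
first moment of a `1`-design is the maximally mixed state
(`IsStateDesign.integrable_integral_linear`), and this is at most `#A` times the norm of `Φ(I/D)`.
Averaging over `ρ` then replaces `ρ` by `I/D` in the first term as well.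

For `Φ = T^{⊗ n}` the Kraus operators are the tensor products of those which the spectral
decomposition of the Choi state provides (`exists_kraus_of_choiState`). The string `s` has weight
`Tr K s (I/D) (K s)† = ∏ k, p (s k)`, with `p` the spectrum of the Choi state, whose Shannon entropy
is `S(τ)`. Taking `A` to be the set of typical strings (`exists_typical_set`), which has at most
`2^{n(S(τ)+δ)}` elements and weight at least `1 - ε` for large `n`, gives the first claim, as the
norm of `T(I/d)^{⊗ n}` is at most the `n`-th power of the norm of `T(I/d)`
(`posSemidef_opNorm_pow_sub`). The second claim follows by choosing `δ` so small that the subtracted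
power tends to `0`.
-/

noncomputable section

namespace QInfo

/-! ### Spectral decomposition and the trace norm of Hermitian matrices -/

section TraceNorm

variable {ι κ : Type*} [Fintype ι] [DecidableEq ι] [Fintype κ] [DecidableEq κ]

/-- The spectral theorem in the form `A = U diag(eigenvalues) Uᴴ`. -/
lemma spectral_eq {A : Matrix ι ι ℂ} (hA : A.IsHermitian) :
    A = (hA.eigenvectorUnitary : Matrix ι ι ℂ) *
      diagonal (fun i => ((hA.eigenvalues i : ℝ) : ℂ)) *
      (hA.eigenvectorUnitary : Matrix ι ι ℂ)ᴴ := by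
  conv_lhs => rw [hA.spectral_theorem, Unitary.conjStarAlgAut_apply]
  rfl

lemma cfc_eq_diagonal {A : Matrix ι ι ℂ} (hA : A.IsHermitian) (f : ℝ → ℝ) :
    cfc f A = (hA.eigenvectorUnitary : Matrix ι ι ℂ) *
      diagonal (fun i => ((f (hA.eigenvalues i) : ℝ) : ℂ)) *
      (hA.eigenvectorUnitary : Matrix ι ι ℂ)ᴴ := by
  rw [hA.cfc_eq, Matrix.IsHermitian.cfc, Unitary.conjStarAlgAut_apply]
  rfl

lemma conjTranspose_mul_eigenvectorUnitary {A : Matrix ι ι ℂ} (hA : A.IsHermitian) :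
    (hA.eigenvectorUnitary : Matrix ι ι ℂ)ᴴ * (hA.eigenvectorUnitary : Matrix ι ι ℂ) = 1 :=
  Matrix.mem_unitaryGroup_iff'.1 hA.eigenvectorUnitary.2

lemma eigenvectorUnitary_mul_conjTranspose {A : Matrix ι ι ℂ} (hA : A.IsHermitian) :
    (hA.eigenvectorUnitary : Matrix ι ι ℂ) * (hA.eigenvectorUnitary : Matrix ι ι ℂ)ᴴ = 1 :=
  Matrix.mem_unitaryGroup_iff.1 hA.eigenvectorUnitary.2

lemma trace_conj_unitary {U D : Matrix ι ι ℂ} (hU : Uᴴ * U = 1) :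
    (U * D * Uᴴ).trace = D.trace := by
  rw [Matrix.trace_mul_comm, ← Matrix.mul_assoc, hU, Matrix.one_mul]

lemma trace_cfc {A : Matrix ι ι ℂ} (hA : A.IsHermitian) (f : ℝ → ℝ) :
    (cfc f A).trace = ∑ i, ((f (hA.eigenvalues i) : ℝ) : ℂ) := by
  rw [cfc_eq_diagonal hA, trace_conj_unitary (conjTranspose_mul_eigenvectorUnitary hA),
    Matrix.trace_diagonal]

lemma traceNorm_eq_sum_abs {A : Matrix ι ι ℂ} (hA : A.IsHermitian) :
    traceNorm A = ∑ i, |hA.eigenvalues i| := by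
  have h1 := trace_cfc (Matrix.isHermitian_conjTranspose_mul_self A) Real.sqrt
  -- As `Aᴴ * A = A ^ 2`, its square root is the absolute value of `A`.
  have h2 : cfc Real.sqrt (Aᴴ * A) = cfc (fun x : ℝ => |x|) A := by
    have : Aᴴ * A = A ^ 2 := by rw [hA.eq, sq]
    rw [this, ← cfc_comp_pow Real.sqrt 2 A (by fun_prop) hA.isSelfAdjoint]
    simp_rw [Real.sqrt_sq_eq_abs]
  rw [h2, trace_cfc hA] at h1
  have h3 := congrArg Complex.re h1
  simp only [Complex.re_sum, Complex.ofReal_re] at h3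
  rw [traceNorm, ← h3]

lemma traceNorm_nonneg (A : Matrix ι ι ℂ) : 0 ≤ traceNorm A :=
  Finset.sum_nonneg fun _ _ => Real.sqrt_nonneg _

lemma re_trace_nonneg {o : Type*} [Fintype o] {A : Matrix o o ℂ} (hA : A.PosSemidef) :
    0 ≤ A.trace.re :=
  (Complex.le_def.1 hA.trace_nonneg).1

lemma traceNorm_eq_zero_iff {A : Matrix ι ι ℂ} (hA : A.IsHermitian) :
    traceNorm A = 0 ↔ A = 0 := by
  rw [traceNorm_eq_sum_abs hA, ← hA.eigenvalues_eq_zero_iff,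
    Finset.sum_eq_zero_iff_of_nonneg fun _ _ => abs_nonneg _, funext_iff]
  simp

/-- Every decomposition of a Hermitian matrix as a difference of positive semidefinite matrices
bounds its trace norm. -/
lemma traceNorm_sub_le {P Q : Matrix ι ι ℂ} (hP : P.PosSemidef) (hQ : Q.PosSemidef) :
    traceNorm (P - Q) ≤ P.trace.re + Q.trace.re := by
  have hA : (P - Q).IsHermitian := hP.1.sub hQ.1
  set U : Matrix ι ι ℂ := (hA.eigenvectorUnitary : Matrix ι ι ℂ) with hUdef
  have hU : U * Uᴴ = 1 := eigenvectorUnitary_mul_conjTranspose hA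
  have hU' : Uᴴ * U = 1 := conjTranspose_mul_eigenvectorUnitary hA
  have hdiag : Uᴴ * (P - Q) * U = diagonal (fun i => ((hA.eigenvalues i : ℝ) : ℂ)) := by
    conv_lhs => rw [spectral_eq hA, ← hUdef]
    rw [← Matrix.mul_assoc, ← Matrix.mul_assoc, hU', Matrix.one_mul, Matrix.mul_assoc, hU',
      Matrix.mul_one]
  have htr : ∀ X : Matrix ι ι ℂ, (Uᴴ * X * U).trace = X.trace := fun X => by
    rw [Matrix.trace_mul_comm, ← Matrix.mul_assoc, hU, Matrix.one_mul]
  have hPd := hP.conjTranspose_mul_mul_same U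
  have hQd := hQ.conjTranspose_mul_mul_same U
  rw [traceNorm_eq_sum_abs hA, ← htr P, ← htr Q]
  simp only [Matrix.trace, Matrix.diag, Complex.re_sum, ← Finset.sum_add_distrib]
  refine Finset.sum_le_sum fun i _ => ?_
  have h1 : hA.eigenvalues i = ((Uᴴ * P * U) i i).re - ((Uᴴ * Q * U) i i).re := by
    have := congrArg (fun M => (M i i).re) hdiag
    simp only [Matrix.mul_sub, Matrix.sub_mul, Matrix.sub_apply, Complex.sub_re,
      Matrix.diagonal_apply_eq, Complex.ofReal_re] at this
    exact this.symm
  have hp : 0 ≤ ((Uᴴ * P * U) i i).re := (Complex.le_def.1 hPd.diag_nonneg).1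
  have hq : 0 ≤ ((Uᴴ * Q * U) i i).re := (Complex.le_def.1 hQd.diag_nonneg).1
  rw [h1, abs_le]
  constructor <;> linarith

/-- The Jordan decomposition attains the bound of `traceNorm_sub_le`. -/
lemma exists_jordan {A : Matrix ι ι ℂ} (hA : A.IsHermitian) :
    ∃ P Q : Matrix ι ι ℂ, P.PosSemidef ∧ Q.PosSemidef ∧ A = P - Q ∧
      P.trace.re + Q.trace.re = traceNorm A := by
  set U : Matrix ι ι ℂ := (hA.eigenvectorUnitary : Matrix ι ι ℂ) with hUdef
  have hU' : Uᴴ * U = 1 := conjTranspose_mul_eigenvectorUnitary hA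
  have key : ∀ f : ι → ℝ, (∀ i, 0 ≤ f i) →
      (U * diagonal (fun i => ((f i : ℝ) : ℂ)) * Uᴴ).PosSemidef := fun f hf =>
    (Matrix.PosSemidef.diagonal (fun i => by simpa using hf i)).mul_mul_conjTranspose_same U
  refine ⟨U * diagonal (fun i => ((max (hA.eigenvalues i) 0 : ℝ) : ℂ)) * Uᴴ,
    U * diagonal (fun i => ((max (-hA.eigenvalues i) 0 : ℝ) : ℂ)) * Uᴴ,
    key _ fun i => le_max_right _ _, key _ fun i => le_max_right _ _, ?_, ?_⟩
  · conv_lhs => rw [spectral_eq hA, ← hUdef]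
    rw [← Matrix.sub_mul, ← Matrix.mul_sub, Matrix.diagonal_sub]
    congr 3
    ext i
    rw [← Complex.ofReal_sub]
    congr 1
    rcases le_total (hA.eigenvalues i) 0 with h | h
    · rw [max_eq_right h, max_eq_left (by linarith)]; ring
    · rw [max_eq_left h, max_eq_right (by linarith)]; ring
  · rw [trace_conj_unitary hU', trace_conj_unitary hU', traceNorm_eq_sum_abs hA]
    simp only [Matrix.trace_diagonal, Complex.re_sum, Complex.ofReal_re,
      ← Finset.sum_add_distrib]
    refine Finset.sum_congr rfl fun i _ => ?_
    rcases le_total (hA.eigenvalues i) 0 with h | h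
    · rw [max_eq_right h, max_eq_left (by linarith), abs_of_nonpos h]; ring
    · rw [max_eq_left h, max_eq_right (by linarith), abs_of_nonneg h]; ring

/-- Adding two Jordan decompositions gives a decomposition of the sum, whence the triangle
inequality. -/
lemma traceNorm_add_le {A B : Matrix ι ι ℂ} (hA : A.IsHermitian) (hB : B.IsHermitian) :
    traceNorm (A + B) ≤ traceNorm A + traceNorm B := by
  obtain ⟨P, Q, hP, hQ, h, ht⟩ := exists_jordan hA
  obtain ⟨P', Q', hP', hQ', h', ht'⟩ := exists_jordan hB
  have := traceNorm_sub_le (hP.add hP') (hQ.add hQ')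
  have e : A + B = P + P' - (Q + Q') := by rw [h, h']; abel
  rw [e]
  simp only [Matrix.trace_add, Complex.add_re] at this
  linarith

/-- Positive trace preserving maps do not increase the trace norm of Hermitian matrices. -/
lemma traceNorm_map_le {Φ : Matrix ι ι ℂ →ₗ[ℂ] Matrix κ κ ℂ}
    (hpos : ∀ X, X.PosSemidef → (Φ X).PosSemidef) (htr : ∀ X, (Φ X).trace = X.trace)
    {A : Matrix ι ι ℂ} (hA : A.IsHermitian) : traceNorm (Φ A) ≤ traceNorm A := by
  obtain ⟨P, Q, hP, hQ, h, ht⟩ := exists_jordan hA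
  have := traceNorm_sub_le (hpos P hP) (hpos Q hQ)
  rw [htr, htr, ht] at this
  rwa [h, map_sub, ← h]

/-- Cauchy–Schwarz comparison of the trace norm with the Hilbert–Schmidt norm. -/
lemma traceNorm_le_sqrt {A : Matrix ι ι ℂ} (hA : A.IsHermitian) :
    traceNorm A ≤ Real.sqrt (Fintype.card ι * (A ^ 2).trace.re) := by
  apply Real.le_sqrt_of_sq_le
  have h : (A ^ 2).trace.re = ∑ i, hA.eigenvalues i ^ 2 := by
    rw [← cfc_pow_id (R := ℝ) A 2 hA.isSelfAdjoint, trace_cfc hA]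
    rw [Complex.re_sum]
    exact Finset.sum_congr rfl fun i _ => Complex.ofReal_re _
  rw [traceNorm_eq_sum_abs hA, h]
  have := sq_sum_le_card_mul_sum_sq (s := Finset.univ) (f := fun i => |hA.eigenvalues i|)
  simpa using this

/-- The trace norm is continuous along continuous families of Hermitian matrices. -/
lemma continuous_traceNorm {X : Type*} [TopologicalSpace X] {f : X → Matrix ι ι ℂ}
    (hf : Continuous f) (hH : ∀ x, (f x).IsHermitian) : Continuous fun x => traceNorm (f x) := by
  rw [continuous_iff_continuousAt]
  intro x₀
  rw [ContinuousAt, tendsto_iff_dist_tendsto_zero]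
  have hc : Continuous fun x =>
      Real.sqrt (Fintype.card ι * ((f x - f x₀) ^ 2).trace.re) := by
    have : Continuous fun x => ((f x - f x₀) ^ 2).trace :=
      ((hf.sub continuous_const).pow 2).matrix_trace
    fun_prop
  have h0 : Filter.Tendsto (fun x => Real.sqrt (Fintype.card ι * ((f x - f x₀) ^ 2).trace.re))
      (nhds x₀) (nhds 0) := by
    have := hc.tendsto x₀
    simpa using this
  refine squeeze_zero (fun _ => dist_nonneg) (fun x => ?_) h0
  have hsub := (hH x).sub (hH x₀)
  refine le_trans ?_ (traceNorm_le_sqrt hsub)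
  have h1 := traceNorm_add_le hsub (hH x₀)
  have h2 := traceNorm_add_le hsub.neg (hH x)
  have h3 : traceNorm (-(f x - f x₀)) = traceNorm (f x - f x₀) := by
    unfold traceNorm
    simp only [Matrix.conjTranspose_neg, neg_mul_neg]
  rw [sub_add_cancel] at h1
  rw [neg_sub, sub_add_cancel, ← neg_sub, h3] at h2
  rw [Real.dist_eq, abs_le]
  constructor <;> linarith

/-- For a traceless Hermitian matrix, compression to a subspace (the range of the isometry `V`)
has trace at most half the trace norm. -/
lemma re_trace_compress_le {A : Matrix ι ι ℂ} (hA : A.IsHermitian) (h0 : A.trace.re = 0)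
    {V : Matrix ι κ ℂ} (hV : Vᴴ * V = 1) :
    (Vᴴ * A * V).trace.re ≤ 1 / 2 * traceNorm A := by
  obtain ⟨P, Q, hP, hQ, h, ht⟩ := exists_jordan hA
  have hPQ : P.trace.re = Q.trace.re := by
    rw [h, Matrix.trace_sub, Complex.sub_re] at h0; linarith
  have hq := re_trace_nonneg (hQ.conjTranspose_mul_mul_same V)
  -- `1 - V * Vᴴ` is a projection, so compressing `P` by it has nonnegative trace.
  have hp : (Vᴴ * P * V).trace.re ≤ P.trace.re := by
    have hR : (1 - V * Vᴴ)ᴴ = 1 - V * Vᴴ := by simp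
    have hR2 : (1 - V * Vᴴ) * (1 - V * Vᴴ) = 1 - V * Vᴴ := by
      have : V * Vᴴ * (V * Vᴴ) = V * Vᴴ := by
        rw [Matrix.mul_assoc, ← Matrix.mul_assoc Vᴴ, hV, Matrix.one_mul]
      rw [Matrix.mul_sub, Matrix.sub_mul, Matrix.sub_mul, this]
      simp
    have h1 := re_trace_nonneg (hP.mul_mul_conjTranspose_same (1 - V * Vᴴ))
    rw [hR, Matrix.trace_mul_comm, ← Matrix.mul_assoc, hR2, Matrix.sub_mul, Matrix.one_mul,
      Matrix.trace_sub, Complex.sub_re, Matrix.mul_assoc, Matrix.trace_mul_comm V] at h1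
    linarith
  have e : (Vᴴ * A * V).trace.re = (Vᴴ * P * V).trace.re - (Vᴴ * Q * V).trace.re := by
    rw [h, Matrix.mul_sub, Matrix.sub_mul, Matrix.trace_sub, Complex.sub_re]
  linarith

/-- Compression to a subspace of dimension `#κ` of a matrix bounded above by `c` has trace at most
`#κ * c`. -/
lemma re_trace_compress_le_of_le {Y : Matrix ι ι ℂ} {c : ℝ}
    (hY : ((c : ℂ) • (1 : Matrix ι ι ℂ) - Y).PosSemidef)
    {V : Matrix ι κ ℂ} (hV : Vᴴ * V = 1) :
    (Vᴴ * Y * V).trace.re ≤ Fintype.card κ * c := by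
  have h := re_trace_nonneg (hY.conjTranspose_mul_mul_same V)
  rw [Matrix.mul_sub, Matrix.sub_mul, Matrix.mul_smul, Matrix.smul_mul, Matrix.mul_one, hV,
    Matrix.trace_sub, Matrix.trace_smul, Matrix.trace_one] at h
  simp at h
  linarith

/-- An isometry whose range is the span of a finite family of vectors. -/
lemma exists_isometry_span {o α : Type*} [Fintype o] (s : Finset α) (x : α → o → ℂ) :
    ∃ (m : ℕ) (V : Matrix o (Fin m) ℂ), m ≤ s.card ∧ Vᴴ * V = 1 ∧
      ∀ a ∈ s, (V * Vᴴ) *ᵥ x a = x a := by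
  classical
  let y : α → EuclideanSpace ℂ o := fun a => WithLp.toLp 2 (x a)
  let E : Submodule ℂ (EuclideanSpace ℂ o) := Submodule.span ℂ (s.image y : Finset _)
  let b := stdOrthonormalBasis ℂ E
  refine ⟨Module.finrank ℂ E, Matrix.of fun i j => (b j : EuclideanSpace ℂ o) i, ?_, ?_, ?_⟩
  · exact (finrank_span_finset_le_card (s.image y)).trans Finset.card_image_le
  · ext j k
    have := orthonormal_iff_ite.1 b.orthonormal j k
    rw [Submodule.coe_inner, EuclideanSpace.inner_eq_star_dotProduct] at this
    rw [Matrix.one_apply, ← this]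
    simp [Matrix.mul_apply, dotProduct, mul_comm]
  · intro a ha
    have hmem : y a ∈ E := Submodule.subset_span (by simpa using ⟨a, ha, rfl⟩)
    have := congrArg (fun z : E => (z : EuclideanSpace ℂ o)) (b.sum_repr' ⟨y a, hmem⟩)
    simp only [Submodule.coe_inner, EuclideanSpace.inner_eq_star_dotProduct] at this
    rw [← Matrix.mulVec_mulVec]
    ext i
    have h2 := congrArg (fun z : EuclideanSpace ℂ o => z i) this
    simp only [AddSubmonoidClass.coe_finsetSum, Submodule.coe_smul, WithLp.ofLp_sum,
      WithLp.ofLp_smul, Finset.sum_apply, Pi.smul_apply, smul_eq_mul, y] at h2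
    refine Eq.trans ?_ h2
    simp [Matrix.mulVec, dotProduct, mul_comm]

end TraceNorm

/-! ### Tensor products of matrices and Kraus operators -/

section Tensor

variable {ι κ S : Type*} [Fintype ι] [DecidableEq ι] [Fintype S]

/-- The tensor product `A 0 ⊗ ⋯ ⊗ A (n - 1)`, as a matrix over the product bases. -/
def tensorProd {ι κ : Type*} {n : ℕ} (A : Fin n → Matrix κ ι ℂ) :
    Matrix (Fin n → κ) (Fin n → ι) ℂ :=
  Matrix.of fun a i => ∏ k, A k (a k) (i k)

lemma prod_sum_pi {ι : Type*} [Fintype ι] {R : Type*} [CommSemiring R] {n : ℕ}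
    (f : Fin n → ι → R) : ∏ k, ∑ i, f k i = ∑ x : Fin n → ι, ∏ k, f k (x k) := by
  rw [Finset.prod_univ_sum, Fintype.piFinset_univ]

lemma tensorProd_mul {ι κ μ : Type*} [Fintype ι] {n : ℕ} (A : Fin n → Matrix κ ι ℂ)
    (B : Fin n → Matrix ι μ ℂ) :
    tensorProd A * tensorProd B = tensorProd fun k => A k * B k := by
  ext a b
  simp only [tensorProd, Matrix.mul_apply, Matrix.of_apply, prod_sum_pi, Finset.prod_mul_distrib]

lemma conjTranspose_tensorProd {ι κ : Type*} {n : ℕ} (A : Fin n → Matrix κ ι ℂ) :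
    (tensorProd A)ᴴ = tensorProd fun k => (A k)ᴴ := by
  ext a b
  simp [tensorProd, Matrix.conjTranspose_apply]

lemma tensorProd_diagonal {ι : Type*} [DecidableEq ι] {n : ℕ} (f : Fin n → ι → ℂ) :
    tensorProd (fun k => diagonal (f k)) = diagonal fun i : Fin n → ι => ∏ k, f k (i k) := by
  ext a b
  by_cases h : a = b
  · subst h; simp [tensorProd]
  · obtain ⟨k, hk⟩ := Function.ne_iff.1 h
    rw [Matrix.diagonal_apply_ne _ h, tensorProd, Matrix.of_apply]
    exact Finset.prod_eq_zero (Finset.mem_univ k) (Matrix.diagonal_apply_ne _ hk)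

lemma tensorProd_one {ι : Type*} [DecidableEq ι] {n : ℕ} :
    tensorProd (fun _ : Fin n => (1 : Matrix ι ι ℂ)) = 1 := by
  simp_rw [← Matrix.diagonal_one, tensorProd_diagonal]
  simp

lemma trace_tensorProd {ι : Type*} [Fintype ι] {n : ℕ} (A : Fin n → Matrix ι ι ℂ) :
    (tensorProd A).trace = ∏ k, (A k).trace := by
  simp [Matrix.trace, tensorProd, prod_sum_pi]

lemma maxMixed_pi (n : ℕ) : maxMixed (Fin n → ι) = tensorProd fun _ => maxMixed ι := by
  have h : maxMixed ι = diagonal fun _ => (Fintype.card ι : ℂ)⁻¹ := by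
    simp [maxMixed, Matrix.smul_one_eq_diagonal]
  rw [h, tensorProd_diagonal, maxMixed, Matrix.smul_one_eq_diagonal]
  simp

lemma map_eq_sum_single {ι κ : Type*} [Fintype ι] [DecidableEq ι]
    (T : Matrix ι ι ℂ →ₗ[ℂ] Matrix κ κ ℂ) (X : Matrix ι ι ℂ) (a b : κ) :
    T X a b = ∑ i, ∑ j, X i j * T (Matrix.single i j 1) a b := by
  conv_lhs => rw [Matrix.matrix_eq_sum_single X]
  simp only [map_sum, Matrix.sum_apply]
  refine Finset.sum_congr rfl fun i _ => Finset.sum_congr rfl fun j _ => ?_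
  have : Matrix.single i j (X i j) = X i j • Matrix.single i j (1 : ℂ) := by simp
  rw [this, map_smul, Matrix.smul_apply, smul_eq_mul]

lemma tensorPower_tensorProd (T : Matrix ι ι ℂ →ₗ[ℂ] Matrix κ κ ℂ) {n : ℕ}
    (X : Fin n → Matrix ι ι ℂ) :
    tensorPower T n (tensorProd X) = tensorProd fun k => T (X k) := by
  ext a b
  simp only [tensorPower, tensorProd, LinearMap.coe_mk, AddHom.coe_mk, Matrix.of_apply]
  simp_rw [map_eq_sum_single T (X _), prod_sum_pi, Finset.prod_mul_distrib]

lemma trace_tensorPower [Fintype κ] {T : Matrix ι ι ℂ →ₗ[ℂ] Matrix κ κ ℂ}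
    (hT : ∀ X, (T X).trace = X.trace) {n : ℕ} (X : Matrix (Fin n → ι) (Fin n → ι) ℂ) :
    (tensorPower T n X).trace = X.trace := by
  have h1 : ∀ i j : Fin n → ι, ∑ a : Fin n → κ, ∏ k, T (Matrix.single (i k) (j k) 1) (a k) (a k)
      = if i = j then 1 else 0 := fun i j => by
    rw [← prod_sum_pi fun k a => T (Matrix.single (i k) (j k) 1) a a]
    have : ∀ k, ∑ a, T (Matrix.single (i k) (j k) 1) a a = (1 : Matrix ι ι ℂ) (i k) (j k) :=
      fun k => by
        change (T (Matrix.single (i k) (j k) 1)).trace = _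
        rw [hT, Matrix.one_apply]
        split_ifs with h
        · rw [h, Matrix.trace_single_eq_same]
        · exact Matrix.trace_single_eq_of_ne _ _ _ h
    simp_rw [this]
    have h2 := congrFun (congrFun (tensorProd_one (ι := ι) (n := n)) i) j
    rw [Matrix.one_apply] at h2
    exact h2
  simp only [Matrix.trace, Matrix.diag, tensorPower, LinearMap.coe_mk, AddHom.coe_mk,
    Matrix.of_apply]
  rw [Finset.sum_comm]
  refine Finset.sum_congr rfl fun i _ => ?_
  rw [Finset.sum_comm]
  simp_rw [← Finset.mul_sum, h1]
  simp

/-- Kraus operators of a map give Kraus operators of its tensor powers. -/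
lemma tensorPower_kraus {T : Matrix ι ι ℂ →ₗ[ℂ] Matrix κ κ ℂ} {K : S → Matrix κ ι ℂ}
    (hK : ∀ X, T X = ∑ s, K s * X * (K s)ᴴ) {n : ℕ} (X : Matrix (Fin n → ι) (Fin n → ι) ℂ) :
    tensorPower T n X =
      ∑ s : Fin n → S, tensorProd (fun k => K (s k)) * X * (tensorProd fun k => K (s k))ᴴ := by
  have hs : ∀ i j a b, T (Matrix.single i j 1) a b = ∑ s, K s a i * star (K s b j) :=
    fun i j a b => by
      rw [hK, Matrix.sum_apply]
      refine Finset.sum_congr rfl fun s _ => ?_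
      simp [Matrix.mul_apply, Matrix.single_apply, ite_and]
  ext a b
  simp only [tensorPower, LinearMap.coe_mk, AddHom.coe_mk, Matrix.of_apply, hs, prod_sum_pi,
    Matrix.sum_apply, Matrix.mul_apply, Matrix.conjTranspose_apply, tensorProd, Finset.sum_mul,
    Finset.mul_sum, Finset.prod_mul_distrib, star_prod]
  rw [Finset.sum_comm]
  refine (Finset.sum_congr rfl fun j _ => Finset.sum_comm).trans ?_
  rw [Finset.sum_comm]
  refine Finset.sum_congr rfl fun s _ => Finset.sum_congr rfl fun j _ =>
    Finset.sum_congr rfl fun i _ => ?_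
  ring

lemma posSemidef_sum_kraus {S : Type*} (A : Finset S) {ι κ : Type*} [Fintype ι] [Fintype κ]
    (K : S → Matrix κ ι ℂ) {X : Matrix ι ι ℂ} (hX : X.PosSemidef) :
    (∑ s ∈ A, K s * X * (K s)ᴴ).PosSemidef :=
  Matrix.posSemidef_sum A fun s _ => hX.mul_mul_conjTranspose_same (K s)

lemma eigenvalues_le_opNorm {A : Matrix ι ι ℂ} (hA : A.IsHermitian) (i : ι) :
    hA.eigenvalues i ≤ opNorm A := by
  have h := (Matrix.toEuclideanCLM (n := ι) (𝕜 := ℂ) A).le_opNorm (hA.eigenvectorBasis i)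
  have e : Matrix.toEuclideanCLM (n := ι) (𝕜 := ℂ) A (hA.eigenvectorBasis i) =
      (hA.eigenvalues i : ℂ) • hA.eigenvectorBasis i := by
    apply (WithLp.equiv 2 _).injective
    have := hA.mulVec_eigenvectorBasis i
    simpa [Matrix.ofLp_toEuclideanCLM] using this
  have h1 : ‖hA.eigenvectorBasis i‖ = 1 := hA.eigenvectorBasis.orthonormal.1 i
  rw [e, norm_smul, h1, mul_one, mul_one, Complex.norm_real, Real.norm_eq_abs] at h
  exact (le_abs_self _).trans h

/-- `M^{⊗ n} ≤ ‖M‖^n` for positive semidefinite `M`. -/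
lemma posSemidef_opNorm_pow_sub {M : Matrix ι ι ℂ} (hM : M.PosSemidef) (n : ℕ) :
    (((opNorm M ^ n : ℝ) : ℂ) • (1 : Matrix (Fin n → ι) (Fin n → ι) ℂ) -
      tensorProd fun _ => M).PosSemidef := by
  have hA := hM.1
  set U : Matrix ι ι ℂ := (hA.eigenvectorUnitary : Matrix ι ι ℂ) with hUdef
  set W : Matrix (Fin n → ι) (Fin n → ι) ℂ := tensorProd fun _ => U with hW
  have hWW : W * Wᴴ = 1 := by
    rw [hW, conjTranspose_tensorProd, tensorProd_mul,
      eigenvectorUnitary_mul_conjTranspose hA, tensorProd_one]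
  have e : (((opNorm M ^ n : ℝ) : ℂ) • (1 : Matrix (Fin n → ι) (Fin n → ι) ℂ) -
      tensorProd fun _ => M) = W * diagonal (fun i : Fin n → ι =>
        ((opNorm M ^ n - ∏ k, hA.eigenvalues (i k) : ℝ) : ℂ)) * Wᴴ := by
    have e1 : (tensorProd fun _ : Fin n => M) =
        W * diagonal (fun i : Fin n → ι => ((∏ k, hA.eigenvalues (i k) : ℝ) : ℂ)) * Wᴴ := by
      conv_lhs => rw [spectral_eq hA, ← hUdef]
      rw [← tensorProd_mul, ← tensorProd_mul, tensorProd_diagonal, hW, conjTranspose_tensorProd]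
      simp
    have e2 : ((opNorm M ^ n : ℝ) : ℂ) • (1 : Matrix (Fin n → ι) (Fin n → ι) ℂ) =
        W * diagonal (fun _ : Fin n → ι => ((opNorm M ^ n : ℝ) : ℂ)) * Wᴴ := by
      rw [← Matrix.smul_one_eq_diagonal, Matrix.mul_smul, Matrix.mul_one, Matrix.smul_mul, hWW]
    rw [e1, e2, ← Matrix.sub_mul, ← Matrix.mul_sub, Matrix.diagonal_sub]
    simp
  rw [e]
  refine (Matrix.PosSemidef.diagonal fun i => ?_).mul_mul_conjTranspose_same W
  rw [Pi.zero_apply, Complex.zero_le_real, sub_nonneg]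
  calc ∏ k, hA.eigenvalues (i k) ≤ ∏ _k : Fin n, opNorm M :=
        Finset.prod_le_prod (fun k _ => hM.eigenvalues_nonneg _)
          fun k _ => eigenvalues_le_opNorm hA _
    _ = opNorm M ^ n := by simp

lemma choiState_apply (T : Matrix ι ι ℂ →ₗ[ℂ] Matrix κ κ ℂ) (a b : κ) (i j : ι) :
    choiState T (a, i) (b, j) = (Fintype.card ι : ℂ)⁻¹ * T (Matrix.single i j 1) a b := by
  have h : (Matrix.of fun i' j' => (Matrix.vecMulVec (maxEntangled ι) (star (maxEntangled ι)))
      (i', i) (j', j)) = (Fintype.card ι : ℂ)⁻¹ • Matrix.single i j (1 : ℂ) := by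
    have hs : ((1 / Real.sqrt (Fintype.card ι) : ℝ) : ℂ) *
        ((1 / Real.sqrt (Fintype.card ι) : ℝ) : ℂ) = (Fintype.card ι : ℂ)⁻¹ := by
      rw [← Complex.ofReal_mul, div_mul_div_comm, Real.mul_self_sqrt (by positivity)]
      simp
    ext i' j'
    by_cases h1 : i' = i
    · by_cases h2 : j' = j
      · subst h1 h2
        simp only [Matrix.of_apply, Matrix.vecMulVec_apply, maxEntangled, Pi.star_apply, if_true,
          Matrix.smul_apply, Matrix.single_apply_same, RCLike.star_def, Complex.conj_ofReal, hs]
        simp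
      · simp [Matrix.vecMulVec_apply, maxEntangled, h2, Ne.symm h2]
    · simp [Matrix.vecMulVec_apply, maxEntangled, h1, Ne.symm h1]
  rw [choiState, ampliation, Matrix.of_apply, h, map_smul, Matrix.smul_apply, smul_eq_mul]

lemma trace_choiState [Fintype κ] {T : Matrix ι ι ℂ →ₗ[ℂ] Matrix κ κ ℂ}
    (hT : ∀ X, (T X).trace = X.trace)
    [Nonempty ι] : (choiState T).trace = 1 := by
  simp only [Matrix.trace, Matrix.diag, Fintype.sum_prod_type, choiState_apply]
  rw [Finset.sum_comm]
  simp_rw [← Finset.mul_sum]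
  have : ∀ i : ι, ∑ a, T (Matrix.single i i 1) a a = 1 := fun i => by
    change (T (Matrix.single i i 1)).trace = 1
    rw [hT, Matrix.trace_single_eq_same]
  simp [this]

/-- The eigenvectors of the Choi state, reshaped into matrices and suitably scaled, are Kraus
operators of the channel. -/
lemma exists_kraus_of_choiState [Fintype κ] [DecidableEq κ] (T : Matrix ι ι ℂ →ₗ[ℂ] Matrix κ κ ℂ)
    (hτ : (choiState T).PosSemidef) [Nonempty ι] :
    ∃ K : κ × ι → Matrix κ ι ℂ, (∀ X, T X = ∑ s, K s * X * (K s)ᴴ) ∧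
      ∀ s, (K s * (K s)ᴴ).trace = Fintype.card ι * (hτ.1.eigenvalues s : ℂ) := by
  have hd : (Fintype.card ι : ℂ) ≠ 0 := by simp
  set p := hτ.1.eigenvalues with hp
  set U : Matrix (κ × ι) (κ × ι) ℂ :=
    (hτ.1.eigenvectorUnitary : Matrix (κ × ι) (κ × ι) ℂ) with hUdef
  have hp0 : ∀ s, 0 ≤ p s := hτ.eigenvalues_nonneg
  have hspec : choiState T = U * diagonal (fun s => ((p s : ℝ) : ℂ)) * Uᴴ := spectral_eq hτ.1
  have hUU : Uᴴ * U = 1 := conjTranspose_mul_eigenvectorUnitary hτ.1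
  clear_value U p
  set c : κ × ι → ℝ := fun s => Real.sqrt (Fintype.card ι * p s) with hc
  have hcc : ∀ s, (c s : ℂ) * (c s : ℂ) = Fintype.card ι * (p s : ℂ) := fun s => by
    rw [← Complex.ofReal_mul, hc, Real.mul_self_sqrt
      (mul_nonneg (Nat.cast_nonneg _) (hp0 s))]
    simp
  refine ⟨fun s => Matrix.of fun a i => (c s : ℂ) * U (a, i) s, fun X => ?_, fun s => ?_⟩
  · ext a b
    have hs : ∀ i j, T (Matrix.single i j 1) a b =
        ∑ s, ((c s : ℂ) * U (a, i) s) * star ((c s : ℂ) * U (b, j) s) := fun i j => by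
      have h1 := choiState_apply T a b i j
      rw [eq_comm, inv_mul_eq_iff_eq_mul₀ hd, hspec] at h1
      rw [h1, Matrix.mul_apply, Finset.mul_sum]
      refine Finset.sum_congr rfl fun s _ => ?_
      rw [Matrix.mul_diagonal, Matrix.conjTranspose_apply, star_mul', Complex.star_def,
        Complex.conj_ofReal]
      linear_combination (-(U (a, i) s * (starRingEnd ℂ) (U (b, j) s))) * hcc s
    rw [map_eq_sum_single]
    simp only [hs, Matrix.sum_apply, Matrix.mul_apply, Matrix.of_apply,
      Matrix.conjTranspose_apply, Finset.sum_mul, Finset.mul_sum]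
    rw [Finset.sum_comm]
    refine (Finset.sum_congr rfl fun j _ => Finset.sum_comm).trans ?_
    rw [Finset.sum_comm]
    refine Finset.sum_congr rfl fun s _ => Finset.sum_congr rfl fun j _ =>
      Finset.sum_congr rfl fun i _ => ?_
    ring
  -- The eigenvectors are normalized, so the trace is the square of the scaling factor `c s`.
  · have hU : (Uᴴ * U) s s = 1 := by
      rw [hUU, Matrix.one_apply_eq]
    rw [Matrix.mul_apply, Fintype.sum_prod_type] at hU
    simp only [Matrix.trace, Matrix.diag, Matrix.mul_apply, Matrix.of_apply,
      Matrix.conjTranspose_apply, star_mul', RCLike.star_def, Complex.conj_ofReal]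
    simp only [Matrix.conjTranspose_apply, RCLike.star_def] at hU
    rw [← mul_one (_ * (p s : ℂ)), ← hU, ← hcc, Finset.mul_sum]
    refine Finset.sum_congr rfl fun a _ => ?_
    rw [Finset.mul_sum]
    refine Finset.sum_congr rfl fun i _ => ?_
    ring

lemma vonNeumannEntropy_eq_sum {ρ : Matrix ι ι ℂ} (hρ : ρ.IsHermitian) :
    vonNeumannEntropy ρ = -∑ i, hρ.eigenvalues i * Real.logb 2 (hρ.eigenvalues i) := by
  have hU := conjTranspose_mul_eigenvectorUnitary hρ
  rw [vonNeumannEntropy, cfc_eq_diagonal hρ]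
  nth_rewrite 1 [spectral_eq hρ]
  rw [show ∀ U D E : Matrix ι ι ℂ, U * D * Uᴴ * (U * E * Uᴴ) = U * D * (Uᴴ * U) * E * Uᴴ by
    intros; simp only [Matrix.mul_assoc], hU, Matrix.mul_one,
    Matrix.mul_assoc _ (diagonal _) (diagonal _),
    Matrix.diagonal_mul_diagonal, trace_conj_unitary hU, Matrix.trace_diagonal]
  simp [Complex.re_sum]

end Tensor

/-! ### Typical sequences -/

section Typical

variable {S : Type*} [Fintype S]

/-- A function equal to `1` at `0` with negative derivative there is below `1` at some `t > 0`. -/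
lemma exists_pos_lt_one_of_hasDerivAt_neg {g : ℝ → ℝ} {g' : ℝ} (h0 : g 0 = 1)
    (hg : HasDerivAt g g' 0) (hneg : g' < 0) : ∃ t, 0 < t ∧ g t < 1 := by
  have h := (hasDerivAt_iff_tendsto_slope.1 hg).eventually (gt_mem_nhds hneg)
  have h2 : ∀ᶠ t in nhdsWithin (0 : ℝ) (Set.Ioi 0), slope g 0 t < 0 :=
    h.filter_mono (nhdsWithin_mono _ fun x hx => ne_of_gt hx)
  obtain ⟨t, ht, htpos⟩ := (h2.and self_mem_nhdsWithin).exists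
  refine ⟨t, htpos, ?_⟩
  rw [slope_def_field, h0, sub_zero] at ht
  have := (div_neg_iff.1 ht).resolve_left fun h => absurd h.2 (not_lt.2 (le_of_lt htpos))
  linarith [this.1]

/-- The asymptotic equipartition property, in the one-sided form: for i.i.d. letters with law `p`,
the strings of probability at least `2^{-n(H+δ)}` number at most `2^{n(H+δ)}` and carry
asymptotically all of the probability. -/
lemma exists_typical_set (p : S → ℝ) (hp : ∀ s, 0 ≤ p s) (hsum : ∑ s, p s = 1)
    {δ ε : ℝ} (hδ : 0 < δ) (hε : 0 < ε) :
    ∃ N : ℕ, ∀ n, N ≤ n → ∃ A : Finset (Fin n → S),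
      (A.card : ℝ) ≤ ((2 : ℝ) ^ (-∑ s, p s * Real.logb 2 (p s) + δ)) ^ n ∧
      1 - ε ≤ ∑ s ∈ A, ∏ k, p (s k) := by
  classical
  set H : ℝ := -∑ s, p s * Real.logb 2 (p s) with hH
  set B : ℝ := (2 : ℝ) ^ (H + δ) with hB
  have hBpos : 0 < B := Real.rpow_pos_of_pos two_pos _
  have hlogB : Real.log B = (H + δ) * Real.log 2 := Real.log_rpow two_pos _
  set c : S → ℝ := fun s => -Real.log (p s) - Real.log B with hc
  have hl2 : 0 < Real.log 2 := Real.log_pos one_lt_two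
  -- The Chernoff bound is governed by the moment generating function of the letter variable `c`.
  obtain ⟨t, ht, hgt⟩ : ∃ t, 0 < t ∧ ∑ s, p s * Real.exp (t * c s) < 1 := by
    have hder : HasDerivAt (fun t : ℝ => ∑ s, p s * Real.exp (t * c s)) (∑ s, p s * c s) 0 := by
      refine HasDerivAt.fun_sum fun s _ => ?_
      have := (((hasDerivAt_id (0 : ℝ)).mul_const (c s)).exp).const_mul (p s)
      simpa using this
    refine exists_pos_lt_one_of_hasDerivAt_neg (by simpa using hsum) hder ?_
    have e : ∑ s, p s * c s = -(δ * Real.log 2) := by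
      have h1 : ∑ s, p s * Real.log (p s) = -H * Real.log 2 := by
        rw [hH, neg_neg, Finset.sum_mul]
        refine Finset.sum_congr rfl fun s _ => ?_
        rw [Real.logb, mul_assoc, div_mul_cancel₀ _ hl2.ne']
      simp only [hc, mul_sub, mul_neg, Finset.sum_sub_distrib, Finset.sum_neg_distrib,
        ← Finset.sum_mul, hsum, h1, hlogB]
      ring
    rw [e]
    have := mul_pos hδ hl2
    linarith
  set g : ℝ := ∑ s, p s * Real.exp (t * c s) with hg
  have hg0 : 0 ≤ g := Finset.sum_nonneg fun s _ => mul_nonneg (hp s) (Real.exp_pos _).le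
  obtain ⟨N, hN⟩ := exists_pow_lt_of_lt_one hε hgt
  refine ⟨N, fun n hn => ?_⟩
  have hgn : g ^ n ≤ ε := (pow_le_pow_of_le_one hg0 hgt.le hn).trans hN.le
  have hq0 : ∀ s : Fin n → S, 0 ≤ ∏ k, p (s k) := fun s => Finset.prod_nonneg fun k _ => hp _
  have htot : ∑ s : Fin n → S, ∏ k, p (s k) = 1 := by
    rw [← prod_sum_pi fun (_ : Fin n) s => p s]
    simp [hsum]
  refine ⟨Finset.univ.filter fun s => 1 ≤ B ^ n * ∏ k, p (s k), ?_, ?_⟩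
  · calc _ = ∑ s ∈ Finset.univ.filter (fun s : Fin n → S => 1 ≤ B ^ n * ∏ k, p (s k)), (1 : ℝ) := by
          simp
      _ ≤ ∑ s ∈ Finset.univ.filter (fun s : Fin n → S => 1 ≤ B ^ n * ∏ k, p (s k)),
            B ^ n * ∏ k, p (s k) := Finset.sum_le_sum fun s hs => (Finset.mem_filter.1 hs).2
      _ ≤ ∑ s : Fin n → S, B ^ n * ∏ k, p (s k) :=
          Finset.sum_le_sum_of_subset_of_nonneg (Finset.filter_subset _ _)
            fun s _ _ => mul_nonneg (pow_nonneg hBpos.le _) (hq0 s)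
      _ = B ^ n := by rw [← Finset.mul_sum, htot, mul_one]
  · rw [← Finset.sum_filter_add_sum_filter_not Finset.univ
      (fun s : Fin n → S => 1 ≤ B ^ n * ∏ k, p (s k))] at htot
    have hbad : ∑ s ∈ Finset.univ.filter (fun s : Fin n → S => ¬ 1 ≤ B ^ n * ∏ k, p (s k)),
        ∏ k, p (s k) ≤ g ^ n := by
      calc _ ≤ ∑ s ∈ Finset.univ.filter (fun s : Fin n → S => ¬ 1 ≤ B ^ n * ∏ k, p (s k)),
            ∏ k, (p (s k) * Real.exp (t * c (s k))) := by
            refine Finset.sum_le_sum fun s hs => ?_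
            have hs' := not_le.1 (Finset.mem_filter.1 hs).2
            rw [Finset.prod_mul_distrib, ← Real.exp_sum, ← Finset.mul_sum]
            -- A string of probability `0` contributes nothing, although `Real.log 0 = 0` makes
            -- the exponent meaningless there.
            rcases (hq0 s).eq_or_lt with h | h
            · rw [← h, zero_mul]
            · refine le_mul_of_one_le_right h.le (Real.one_le_exp (mul_nonneg ht.le ?_))
              have hne : ∀ k ∈ Finset.univ, p (s k) ≠ 0 := fun k hk h0 =>
                h.ne' (Finset.prod_eq_zero hk h0)
              have e : ∑ k, c (s k) = -Real.log (B ^ n * ∏ k, p (s k)) := by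
                rw [Real.log_mul (pow_pos hBpos n).ne' h.ne', Real.log_prod hne, Real.log_pow]
                simp [hc, Finset.sum_sub_distrib]
                ring
              rw [e]
              exact neg_nonneg.2 (Real.log_nonpos
                (mul_nonneg (pow_nonneg hBpos.le _) (hq0 s)) hs'.le)
        _ ≤ ∑ s : Fin n → S, ∏ k, (p (s k) * Real.exp (t * c (s k))) :=
            Finset.sum_le_sum_of_subset_of_nonneg (Finset.filter_subset _ _) fun s _ _ =>
              Finset.prod_nonneg fun k _ => mul_nonneg (hp _) (Real.exp_pos _).le
        _ = g ^ n := by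
            rw [← prod_sum_pi fun (_ : Fin n) s => p s * Real.exp (t * c s)]
            simp [hg]
    linarith

end Typical

/-! ### Averages over state designs -/

section Designs

variable {ι : Type*} [Fintype ι] [DecidableEq ι]

instance instSecondCountableTopologyMatrix {ι : Type*} [Fintype ι] :
    SecondCountableTopology (Matrix ι ι ℂ) :=
  inferInstanceAs (SecondCountableTopology (ι → ι → ℂ))

instance instSecondCountableTopologyPureState {ι : Type*} [Fintype ι] :
    SecondCountableTopology (PureState ι) :=
  TopologicalSpace.Subtype.secondCountableTopology
    {ρ : Matrix ι ι ℂ | ∃ ψ : ι → ℂ, star ψ ⬝ᵥ ψ = 1 ∧ ρ = Matrix.vecMulVec ψ (star ψ)}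

instance instIsProbabilityMeasureHaarUnitary : IsProbabilityMeasure (haarUnitary ι) :=
  ⟨by
    simpa [haarUnitary] using Measure.haarMeasure_self
      (K₀ := (⊤ : TopologicalSpace.PositiveCompacts (Matrix.unitaryGroup ι ℂ)))⟩

instance instIsMulLeftInvariantHaarUnitary : (haarUnitary ι).IsMulLeftInvariant :=
  inferInstanceAs (Measure.haarMeasure ⊤).IsMulLeftInvariant

lemma continuous_rotate (φ : PureState ι) : Continuous fun U => rotate U φ := by
  refine Continuous.subtype_mk ?_ _
  fun_prop

lemma integrable_unitaryGroup {f : Matrix.unitaryGroup ι ℂ → ℂ} (hf : Continuous f)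
    (ν : Measure (Matrix.unitaryGroup ι ℂ)) [IsFiniteMeasure ν] : Integrable f ν :=
  hf.integrable_of_hasCompactSupport (HasCompactSupport.of_compactSpace f)

open scoped Matrix.Norms.L2Operator in
/-- The unitary group acts irreducibly: its commutant consists of the scalars. -/
lemma mem_range_scalar_of_commute_unitary {M : Matrix ι ι ℂ}
    (h : ∀ V ∈ Matrix.unitaryGroup ι ℂ, Commute V M) : M ∈ Set.range (Matrix.scalar ι) := by
  refine Matrix.mem_range_scalar_of_commute_single fun i j _ => ?_
  have hmem : Matrix.single i j (1 : ℂ) ∈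
      Submodule.span ℂ (unitary (Matrix ι ι ℂ) : Set (Matrix ι ι ℂ)) := by
    rw [CStarAlgebra.span_unitary]
    trivial
  change Commute (Matrix.single i j (1 : ℂ)) M
  generalize Matrix.single i j (1 : ℂ) = X at hmem ⊢
  induction hmem using Submodule.span_induction with
  | mem x hx => exact h x hx
  | zero => exact Commute.zero_left _
  | add x y _ _ hx hy => exact hx.add_left hy
  | smul a x _ hx => exact hx.smul_left a

/-- By invariance, the Haar average of `U φ U†` commutes with every unitary, so it is a multiple of
the identity; the trace determines the multiple. -/
lemma integral_conj_haarUnitary (φ : Matrix ι ι ℂ) (i j : ι) :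
    ∫ U : Matrix.unitaryGroup ι ℂ, ((U : Matrix ι ι ℂ) * φ * (U : Matrix ι ι ℂ)ᴴ) i j
      ∂(haarUnitary ι) = φ.trace * maxMixed ι i j := by
  set F : Matrix.unitaryGroup ι ℂ → Matrix ι ι ℂ :=
    fun U => (U : Matrix ι ι ℂ) * φ * (U : Matrix ι ι ℂ)ᴴ with hF
  have hFc : ∀ i j, Continuous fun U => F U i j := fun i j => by
    have : Continuous F := by fun_prop
    exact this.matrix_elem i j
  have hFi : ∀ i j, Integrable (fun U => F U i j) (haarUnitary ι) := fun i j =>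
    integrable_unitaryGroup (hFc i j) _
  set M : Matrix ι ι ℂ := Matrix.of fun i j => ∫ U, F U i j ∂(haarUnitary ι) with hM
  have hinv : ∀ V : Matrix.unitaryGroup ι ℂ, (V : Matrix ι ι ℂ) * M * (V : Matrix ι ι ℂ)ᴴ = M :=
    fun V => by
      ext i j
      have h1 : ∀ U, F (V * U) i j =
          ∑ l, ∑ k, (V : Matrix ι ι ℂ) i k * (V : Matrix ι ι ℂ)ᴴ l j * F U k l := fun U => by
        have : F (V * U) = (V : Matrix ι ι ℂ) * F U * (V : Matrix ι ι ℂ)ᴴ := by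
          simp only [hF, Submonoid.coe_mul, Matrix.conjTranspose_mul, Matrix.mul_assoc]
        rw [this, Matrix.mul_apply]
        refine Finset.sum_congr rfl fun l _ => ?_
        rw [Matrix.mul_apply, Finset.sum_mul]
        refine Finset.sum_congr rfl fun k _ => by ring
      have h2 : M i j = ∫ U, F (V * U) i j ∂(haarUnitary ι) :=
        (integral_mul_left_eq_self (fun U => F U i j) V).symm
      rw [h2]
      simp_rw [h1]
      rw [integral_finsetSum _ fun l _ => integrable_finsetSum _ fun k _ =>
        (hFi k l).const_mul _, Matrix.mul_apply]
      refine Finset.sum_congr rfl fun l _ => ?_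
      rw [integral_finsetSum _ fun k _ => (hFi k l).const_mul _, Matrix.mul_apply,
        Finset.sum_mul]
      refine Finset.sum_congr rfl fun k _ => ?_
      rw [integral_const_mul, hM, Matrix.of_apply]
      ring
  obtain ⟨c, hc⟩ := mem_range_scalar_of_commute_unitary (M := M) fun V hV => by
    have h1 := hinv ⟨V, hV⟩
    have h2 : Vᴴ * V = 1 := Matrix.mem_unitaryGroup_iff'.1 hV
    have h3 := congrArg (· * V) h1
    simp only [Matrix.mul_assoc, h2, Matrix.mul_one] at h3
    exact h3
  have htr : M.trace = φ.trace := by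
    have h1 : M.trace = ∫ U, (F U).trace ∂(haarUnitary ι) := by
      simp only [Matrix.trace, Matrix.diag]
      rw [integral_finsetSum _ fun i _ => hFi i i]
      rfl
    have h2 : ∀ U, (F U).trace = φ.trace := fun U =>
      trace_conj_unitary (Matrix.mem_unitaryGroup_iff'.1 U.2)
    rw [h1]
    simp [h2]
  have hcard : (Fintype.card ι : ℂ) ≠ 0 := by
    have : Nonempty ι := ⟨i⟩
    simp
  have hc' : c = φ.trace * (Fintype.card ι : ℂ)⁻¹ := by
    rw [← htr, ← hc, Matrix.scalar_apply, Matrix.trace_diagonal]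
    simp
    field_simp
  change M i j = _
  rw [← hc, hc', maxMixed, Matrix.smul_one_eq_diagonal, Matrix.scalar_apply]
  by_cases h : i = j
  · subst h; simp
  · simp [h]

lemma trace_pureState {ι : Type*} [Fintype ι] (ρ : PureState ι) : ρ.1.trace = 1 := by
  obtain ⟨ψ, hψ, h⟩ := ρ.2
  rw [h, Matrix.trace_vecMulVec, dotProduct_comm, hψ]

lemma posSemidef_pureState {ι : Type*} [Fintype ι] (ρ : PureState ι) : ρ.1.PosSemidef := by
  obtain ⟨ψ, hψ, h⟩ := ρ.2
  rw [h]
  exact Matrix.posSemidef_vecMulVec_self_star ψ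

/-- The design property is used only for the monomials `U i k * U† l j`. -/
lemma IsUnitaryDesign.integral_entry_mul {ν : Measure (Matrix.unitaryGroup ι ℂ)}
    (hν : IsUnitaryDesign 1 ν) (a b : ι × ι) :
    ∫ U : Matrix.unitaryGroup ι ℂ, (U : Matrix ι ι ℂ) a.1 a.2 * (U : Matrix ι ι ℂ)ᴴ b.1 b.2 ∂ν =
      ∫ U : Matrix.unitaryGroup ι ℂ, (U : Matrix ι ι ℂ) a.1 a.2 * (U : Matrix ι ι ℂ)ᴴ b.1 b.2
        ∂(haarUnitary ι) := by
  have h := hν.2 (MvPolynomial.X (Sum.inl a) * MvPolynomial.X (Sum.inr b)) fun m hm => by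
    rw [MvPolynomial.X, MvPolynomial.X, MvPolynomial.monomial_mul, one_mul,
      MvPolynomial.support_monomial, if_neg one_ne_zero, Finset.mem_singleton] at hm
    subst hm
    simp [Finsupp.single_apply]
  simpa [evalUnitary] using h

/-- The first moment of a state `1`-design is the maximally mixed state. -/
lemma IsStateDesign.integrable_integral_linear {μ : Measure (PureState ι)}
    (hμ : IsStateDesign 1 μ) (L : Matrix ι ι ℂ →ₗ[ℂ] ℂ) :
    Integrable (fun ρ : PureState ι => L ρ.1) μ ∧ ∫ ρ, L ρ.1 ∂μ = L (maxMixed ι) := by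
  obtain ⟨φ, ν, hν, rfl⟩ := hμ
  have := hν.1
  have hm : AEMeasurable (fun U => rotate U φ) ν := (continuous_rotate φ).measurable.aemeasurable
  have hLc : Continuous L := L.continuous_of_finiteDimensional
  have hc : Continuous fun ρ : PureState ι => L ρ.1 := hLc.comp continuous_subtype_val
  have hsm := hc.aestronglyMeasurable (μ := ν.map fun U => rotate U φ)
  have hexp : ∀ X, L X = ∑ i, ∑ j, X i j * L (Matrix.single i j 1) := fun X => by
    conv_lhs => rw [Matrix.matrix_eq_sum_single X]
    simp only [map_sum]
    refine Finset.sum_congr rfl fun i _ => Finset.sum_congr rfl fun j _ => ?_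
    have : Matrix.single i j (X i j) = X i j • Matrix.single i j (1 : ℂ) := by simp
    rw [this, map_smul, smul_eq_mul]
  constructor
  · rw [integrable_map_measure hsm hm]
    exact integrable_unitaryGroup (hc.comp (continuous_rotate φ)) ν
  rw [integral_map hm hsm]
  set F : Matrix.unitaryGroup ι ℂ → Matrix ι ι ℂ :=
    fun U => (U : Matrix ι ι ℂ) * φ.1 * (U : Matrix ι ι ℂ)ᴴ with hF
  have hFc : Continuous F := by fun_prop
  have hent : ∀ i j, ∫ U, F U i j ∂ν = maxMixed ι i j := fun i j => by
    have h1 : ∀ U, F U i j = ∑ l, ∑ k, φ.1 k l *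
        ((U : Matrix ι ι ℂ) i k * (U : Matrix ι ι ℂ)ᴴ l j) := fun U => by
      simp only [hF]
      rw [Matrix.mul_apply]
      refine Finset.sum_congr rfl fun l _ => ?_
      rw [Matrix.mul_apply, Finset.sum_mul]
      exact Finset.sum_congr rfl fun k _ => by ring
    have hi : ∀ (k l : ι) (ν' : Measure (Matrix.unitaryGroup ι ℂ)) [IsFiniteMeasure ν'],
        Integrable (fun U : Matrix.unitaryGroup ι ℂ => φ.1 k l *
          ((U : Matrix ι ι ℂ) i k * (U : Matrix ι ι ℂ)ᴴ l j)) ν' := fun k l ν' _ => by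
      refine integrable_unitaryGroup ?_ ν'
      have h1 : Continuous fun U : Matrix.unitaryGroup ι ℂ => (U : Matrix ι ι ℂ) i k :=
        continuous_subtype_val.matrix_elem i k
      have h2 : Continuous fun U : Matrix.unitaryGroup ι ℂ => (U : Matrix ι ι ℂ)ᴴ l j :=
        (continuous_subtype_val.matrix_conjTranspose).matrix_elem l j
      exact continuous_const.mul (h1.mul h2)
    have hsum : ∀ (ν' : Measure (Matrix.unitaryGroup ι ℂ)) [IsFiniteMeasure ν'],
        ∫ U, F U i j ∂ν' = ∑ l, ∑ k, φ.1 k l * ∫ U : Matrix.unitaryGroup ι ℂ,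
          (U : Matrix ι ι ℂ) i k * (U : Matrix ι ι ℂ)ᴴ l j ∂ν' := fun ν' _ => by
      simp_rw [h1]
      rw [integral_finsetSum _ fun l _ => integrable_finsetSum _ fun k _ => hi k l ν']
      refine Finset.sum_congr rfl fun l _ => ?_
      rw [integral_finsetSum _ fun k _ => hi k l ν']
      exact Finset.sum_congr rfl fun k _ => integral_const_mul _ _
    have h2 := integral_conj_haarUnitary φ.1 i j
    rw [trace_pureState, one_mul] at h2
    rw [← h2]
    change _ = ∫ U, F U i j ∂(haarUnitary ι)
    rw [hsum ν, hsum (haarUnitary ι)]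
    refine Finset.sum_congr rfl fun l _ => Finset.sum_congr rfl fun k _ => ?_
    rw [hν.integral_entry_mul (i, k) (l, j)]
  have hFi : ∀ i j, Integrable (fun U => F U i j * L (Matrix.single i j 1)) ν := fun i j =>
    integrable_unitaryGroup ((hFc.matrix_elem i j).mul continuous_const) ν
  change ∫ U, L (F U) ∂ν = _
  rw [hexp (maxMixed ι)]
  simp_rw [hexp (F _)]
  rw [integral_finsetSum _ fun i _ => integrable_finsetSum _ fun j _ => hFi i j]
  refine Finset.sum_congr rfl fun i _ => ?_
  rw [integral_finsetSum _ fun j _ => hFi i j]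
  refine Finset.sum_congr rfl fun j _ => ?_
  rw [integral_mul_const, hent]

lemma IsStateDesign.integrable_re {μ : Measure (PureState ι)}
    (hμ : IsStateDesign 1 μ) (L : Matrix ι ι ℂ →ₗ[ℂ] ℂ) :
    Integrable (fun ρ : PureState ι => (L ρ.1).re) μ :=
  (hμ.integrable_integral_linear L).1.re

lemma IsStateDesign.integral_re {μ : Measure (PureState ι)}
    (hμ : IsStateDesign 1 μ) (L : Matrix ι ι ℂ →ₗ[ℂ] ℂ) :
    ∫ ρ : PureState ι, (L ρ.1).re ∂μ = (L (maxMixed ι)).re := by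
  obtain ⟨h1, h2⟩ := hμ.integrable_integral_linear L
  rw [← h2]
  exact _root_.integral_re h1

end Designs

/-! ### Average contraction of the trace distance -/

section Contraction

variable {ι κ : Type*} [Fintype ι] [DecidableEq ι] [Fintype κ] [DecidableEq κ]
  {Φ : Matrix ι ι ℂ →ₗ[ℂ] Matrix κ κ ℂ}

lemma isHermitian_sub_pureState {ι : Type*} [Fintype ι] (ρ σ : PureState ι) :
    (ρ.1 - σ.1).IsHermitian :=
  (posSemidef_pureState ρ).1.sub (posSemidef_pureState σ).1

lemma traceDist_nonneg (ρ σ : Matrix ι ι ℂ) : 0 ≤ traceDist ρ σ :=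
  mul_nonneg (by norm_num) (traceNorm_nonneg _)

lemma traceDist_pureState_le_one (ρ σ : PureState ι) : traceDist ρ.1 σ.1 ≤ 1 := by
  have := traceNorm_sub_le (posSemidef_pureState ρ) (posSemidef_pureState σ)
  rw [trace_pureState, trace_pureState, Complex.one_re] at this
  rw [traceDist]
  linarith

lemma traceDist_pureState_pos {ρ σ : PureState ι} (h : ρ ≠ σ) : 0 < traceDist ρ.1 σ.1 := by
  refine mul_pos (by norm_num) ((traceNorm_nonneg _).lt_of_ne' fun h0 => h ?_)
  rw [traceNorm_eq_zero_iff (isHermitian_sub_pureState ρ σ)] at h0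
  exact Subtype.ext (sub_eq_zero.1 h0)

lemma traceDist_map_le (hpos : ∀ X, X.PosSemidef → (Φ X).PosSemidef)
    (htr : ∀ X, (Φ X).trace = X.trace) (ρ σ : PureState ι) :
    traceDist (Φ ρ.1) (Φ σ.1) ≤ traceDist ρ.1 σ.1 := by
  rw [traceDist, traceDist, ← map_sub]
  have := traceNorm_map_le hpos htr (isHermitian_sub_pureState ρ σ)
  linarith

lemma continuous_traceDist_map {ι : Type*} [Fintype ι] {Φ : Matrix ι ι ℂ →ₗ[ℂ] Matrix κ κ ℂ}
    (hpos : ∀ X, X.PosSemidef → (Φ X).PosSemidef) :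
    Continuous fun p : PureState ι × PureState ι => traceDist (Φ p.1.1) (Φ p.2.1) := by
  have hΦ : Continuous Φ := Φ.continuous_of_finiteDimensional
  refine continuous_const.mul (continuous_traceNorm ?_ fun p => ?_)
  · exact (hΦ.comp (continuous_subtype_val.comp continuous_fst)).sub
      (hΦ.comp (continuous_subtype_val.comp continuous_snd))
  · exact (hpos _ (posSemidef_pureState p.1)).1.sub (hpos _ (posSemidef_pureState p.2)).1

lemma contraction_le_one (hpos : ∀ X, X.PosSemidef → (Φ X).PosSemidef)
    (htr : ∀ X, (Φ X).trace = X.trace) (ρ σ : PureState ι) :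
    traceDist (Φ ρ.1) (Φ σ.1) / traceDist ρ.1 σ.1 ≤ 1 :=
  div_le_one_of_le₀ (traceDist_map_le hpos htr ρ σ) (traceDist_nonneg _ _)

lemma integrable_contraction (hpos : ∀ X, X.PosSemidef → (Φ X).PosSemidef)
    (htr : ∀ X, (Φ X).trace = X.trace) (ν : Measure (PureState ι × PureState ι))
    [IsFiniteMeasure ν] :
    Integrable (fun p => traceDist (Φ p.1.1) (Φ p.2.1) / traceDist p.1.1 p.2.1) ν := by
  have h1 := (continuous_traceDist_map hpos).measurable
  have h2 := (continuous_traceDist_map (Φ := LinearMap.id (R := ℂ) (M := Matrix ι ι ℂ))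
    fun _ h => h).measurable
  refine Integrable.of_bound (h1.div h2).aestronglyMeasurable 1 (Filter.Eventually.of_forall ?_)
  intro p
  rw [Real.norm_eq_abs, abs_of_nonneg (div_nonneg (traceDist_nonneg _ _) (traceDist_nonneg _ _))]
  exact contraction_le_one hpos htr p.1 p.2

lemma integrable_traceDist_map (hpos : ∀ X, X.PosSemidef → (Φ X).PosSemidef)
    (htr : ∀ X, (Φ X).trace = X.trace) (ν : Measure (PureState ι × PureState ι))
    [IsFiniteMeasure ν] :
    Integrable (fun p => traceDist (Φ p.1.1) (Φ p.2.1)) ν := by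
  refine Integrable.of_bound (continuous_traceDist_map hpos).measurable.aestronglyMeasurable 1
    (Filter.Eventually.of_forall fun p => ?_)
  rw [Real.norm_eq_abs, abs_of_nonneg (traceDist_nonneg _ _)]
  exact (traceDist_map_le hpos htr p.1 p.2).trans (traceDist_pureState_le_one p.1 p.2)

lemma integrable_traceDist_map_right (hpos : ∀ X, X.PosSemidef → (Φ X).PosSemidef)
    (htr : ∀ X, (Φ X).trace = X.trace) (μ : Measure (PureState ι)) [IsFiniteMeasure μ]
    (ρ : PureState ι) : Integrable (fun σ : PureState ι => traceDist (Φ ρ.1) (Φ σ.1)) μ := by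
  have hm : Measurable fun σ : PureState ι => traceDist (Φ ρ.1) (Φ σ.1) := by
    have h1 := (continuous_traceDist_map hpos).measurable
    have h2 : Measurable (Prod.mk ρ : PureState ι → PureState ι × PureState ι) :=
      measurable_prodMk_left
    have h3 := h1.comp h2
    exact h3
  refine Integrable.of_bound hm.aestronglyMeasurable 1 (Filter.Eventually.of_forall fun σ => ?_)
  rw [Real.norm_eq_abs, abs_of_nonneg (traceDist_nonneg _ _)]
  exact (traceDist_map_le hpos htr ρ σ).trans (traceDist_pureState_le_one ρ σ)

lemma avgContraction_le_one (hpos : ∀ X, X.PosSemidef → (Φ X).PosSemidef)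
    (htr : ∀ X, (Φ X).trace = X.trace) (ν : Measure (PureState ι × PureState ι))
    [IsProbabilityMeasure ν] : avgContraction Φ ν ≤ 1 := by
  have := integral_mono (integrable_contraction hpos htr ν) (integrable_const (1 : ℝ))
    fun p => contraction_le_one hpos htr p.1 p.2
  simpa [avgContraction] using this

/-- Two independent states drawn from a continuous distribution are almost surely different. -/
lemma ae_fst_ne_snd {ι : Type*} [Fintype ι] (μ : Measure (PureState ι)) [SFinite μ]
    [NullSingletonClass μ] :
    ∀ᵐ p ∂(μ.prod μ), p.1 ≠ p.2 := by
  have hd : MeasurableSet {p : PureState ι × PureState ι | p.1 = p.2} :=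
    (isClosed_eq continuous_fst continuous_snd).measurableSet
  rw [ae_iff]
  simp only [ne_eq, not_not]
  rw [Measure.measure_prod_null hd]
  refine Filter.Eventually.of_forall fun ρ => ?_
  have : Prod.mk ρ ⁻¹' {p : PureState ι × PureState ι | p.1 = p.2} = {ρ} := by
    ext σ
    simp [eq_comm]
  change μ (Prod.mk ρ ⁻¹' {p : PureState ι × PureState ι | p.1 = p.2}) = 0
  rw [this]
  exact measure_singleton ρ

/-- Since pure states have trace distance at most `1`, the average contraction is at least the
average trace distance of the outputs. -/
lemma integral_traceDist_le_avgContraction (hpos : ∀ X, X.PosSemidef → (Φ X).PosSemidef)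
    (htr : ∀ X, (Φ X).trace = X.trace) (μ : Measure (PureState ι)) [IsProbabilityMeasure μ]
    [NullSingletonClass μ] :
    ∫ ρ, ∫ σ, traceDist (Φ ρ.1) (Φ σ.1) ∂μ ∂μ ≤ avgContraction Φ (μ.prod μ) := by
  rw [← integral_prod (fun p : PureState ι × PureState ι => traceDist (Φ p.1.1) (Φ p.2.1))
    (integrable_traceDist_map hpos htr (μ.prod μ))]
  refine integral_mono_ae (integrable_traceDist_map hpos htr _)
    (integrable_contraction hpos htr _) ?_
  filter_upwards [ae_fst_ne_snd μ] with p hp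
  exact le_div_self (traceDist_nonneg _ _) (traceDist_pureState_pos hp)
    (traceDist_pureState_le_one _ _)

/-- For a pure state `ρ`, the part of the output that comes from a set `A` of Kraus operators has
rank at most `#A`; measuring the projection on its range distinguishes `Φ ρ` from the average
output. -/
lemma le_integral_traceDist {S : Type*} [Fintype S] {K : S → Matrix κ ι ℂ}
    (hK : ∀ X, Φ X = ∑ s, K s * X * (K s)ᴴ) (htr : ∀ X, (Φ X).trace = X.trace)
    {μ : Measure (PureState ι)} [IsProbabilityMeasure μ] (hμ : IsStateDesign 1 μ)
    (A : Finset S) {c : ℝ} (hc0 : 0 ≤ c)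
    (hc : ((c : ℂ) • (1 : Matrix κ κ ℂ) - Φ (maxMixed ι)).PosSemidef) (ρ : PureState ι) :
    (∑ s ∈ A, K s * ρ.1 * (K s)ᴴ).trace.re - A.card * c ≤
      ∫ σ, traceDist (Φ ρ.1) (Φ σ.1) ∂μ := by
  classical
  have hpos : ∀ X, X.PosSemidef → (Φ X).PosSemidef := fun X hX => by
    rw [hK]; exact posSemidef_sum_kraus _ K hX
  obtain ⟨ψ, -, hψ⟩ := ρ.2
  obtain ⟨m, V, hm, hV, hVx⟩ := exists_isometry_span A fun s => K s *ᵥ ψ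
  let L : Matrix ι ι ℂ →ₗ[ℂ] ℂ :=
    { toFun := fun X => (Vᴴ * Φ X * V).trace
      map_add' := fun X Y => by rw [map_add, Matrix.mul_add, Matrix.add_mul, Matrix.trace_add]
      map_smul' := fun a X => by
        rw [map_smul, Matrix.mul_smul, Matrix.smul_mul, Matrix.trace_smul]; rfl }
  -- On the range of `V`, which contains the vectors `K s ψ`, compression loses nothing; the
  -- operators outside `A` can only add to the trace.
  have hfirst : (∑ s ∈ A, K s * ρ.1 * (K s)ᴴ).trace.re ≤ (L ρ.1).re := by
    have hsplit : Φ ρ.1 = ∑ s ∈ A, K s * ρ.1 * (K s)ᴴ + ∑ s ∈ Aᶜ, K s * ρ.1 * (K s)ᴴ := by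
      rw [hK, Finset.sum_add_sum_compl]
    have hfix : V * Vᴴ * (∑ s ∈ A, K s * ρ.1 * (K s)ᴴ) = ∑ s ∈ A, K s * ρ.1 * (K s)ᴴ := by
      rw [Finset.mul_sum]
      refine Finset.sum_congr rfl fun s hs => ?_
      rw [hψ, Matrix.mul_vecMulVec, Matrix.vecMulVec_mul, Matrix.mul_vecMulVec, hVx s hs]
    have h1 : (Vᴴ * (∑ s ∈ A, K s * ρ.1 * (K s)ᴴ) * V).trace =
        (∑ s ∈ A, K s * ρ.1 * (K s)ᴴ).trace := by
      rw [Matrix.trace_mul_comm, ← Matrix.mul_assoc, hfix]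
    have h2 := re_trace_nonneg ((posSemidef_sum_kraus Aᶜ K
      (posSemidef_pureState ρ)).conjTranspose_mul_mul_same V)
    change _ ≤ (Vᴴ * Φ ρ.1 * V).trace.re
    rw [hsplit, Matrix.mul_add, Matrix.add_mul, Matrix.trace_add, h1, Complex.add_re]
    linarith
  have hsecond : (L (maxMixed ι)).re ≤ A.card * c := by
    have h1 := re_trace_compress_le_of_le hc hV
    rw [Fintype.card_fin] at h1
    exact h1.trans (mul_le_mul_of_nonneg_right (Nat.cast_le.2 hm) hc0)
  have hint := integrable_traceDist_map_right hpos htr μ ρ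
  have hmono : ∫ σ : PureState ι, ((L ρ.1).re - (L σ.1).re) ∂μ ≤
      ∫ σ, traceDist (Φ ρ.1) (Φ σ.1) ∂μ := by
    refine integral_mono ((integrable_const _).sub (hμ.integrable_re L)) hint fun σ => ?_
    have hH : (Φ ρ.1 - Φ σ.1).IsHermitian :=
      (hpos _ (posSemidef_pureState ρ)).1.sub (hpos _ (posSemidef_pureState σ)).1
    have h0 : (Φ ρ.1 - Φ σ.1).trace.re = 0 := by
      rw [Matrix.trace_sub, htr, htr, trace_pureState, trace_pureState, sub_self, Complex.zero_re]
    have h1 := re_trace_compress_le hH h0 hV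
    rw [Matrix.mul_sub, Matrix.sub_mul, Matrix.trace_sub, Complex.sub_re] at h1
    exact h1
  rw [integral_sub (integrable_const _) (hμ.integrable_re L), hμ.integral_re L] at hmono
  simp only [integral_const, probReal_univ, one_smul] at hmono
  linarith

/-- The one-shot lower bound on the average contraction. -/
lemma le_avgContraction {S : Type*} [Fintype S] {K : S → Matrix κ ι ℂ}
    (hK : ∀ X, Φ X = ∑ s, K s * X * (K s)ᴴ) (htr : ∀ X, (Φ X).trace = X.trace)
    {μ : Measure (PureState ι)} [IsProbabilityMeasure μ] [NullSingletonClass μ]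
    (hμ : IsStateDesign 1 μ) (A : Finset S) {c : ℝ} (hc0 : 0 ≤ c)
    (hc : ((c : ℂ) • (1 : Matrix κ κ ℂ) - Φ (maxMixed ι)).PosSemidef) :
    (∑ s ∈ A, K s * maxMixed ι * (K s)ᴴ).trace.re - A.card * c ≤
      avgContraction Φ (μ.prod μ) := by
  have hpos : ∀ X, X.PosSemidef → (Φ X).PosSemidef := fun X hX => by
    rw [hK]; exact posSemidef_sum_kraus _ K hX
  refine le_trans ?_ (integral_traceDist_le_avgContraction hpos htr μ)
  let L : Matrix ι ι ℂ →ₗ[ℂ] ℂ :=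
    { toFun := fun X => (∑ s ∈ A, K s * X * (K s)ᴴ).trace
      map_add' := fun X Y => by
        simp only [Matrix.mul_add, Matrix.add_mul, Finset.sum_add_distrib, Matrix.trace_add]
      map_smul' := fun a X => by
        simp only [Matrix.mul_smul, Matrix.smul_mul, ← Finset.smul_sum, Matrix.trace_smul,
          RingHom.id_apply] }
  have h := integral_mono ((hμ.integrable_re L).sub (integrable_const (A.card * c)))
    (integrable_traceDist_map hpos htr (μ.prod μ)).integral_prod_left
    fun ρ => le_integral_traceDist hK htr hμ A hc0 hc ρ
  refine le_trans (le_of_eq ?_) h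
  have e : ∫ ρ : PureState ι, ((L ρ.1).re - A.card * c) ∂μ = (L (maxMixed ι)).re - A.card * c := by
    rw [integral_sub (hμ.integrable_re L) (integrable_const _), hμ.integral_re L]
    simp
  exact e.symm

end Contraction

/-! ### Tensor powers of a channel -/

section Powers

variable {ι κ : Type*} [Fintype ι] [DecidableEq ι] [Fintype κ] [DecidableEq κ] [Nonempty ι]
  {T : Matrix ι ι ℂ →ₗ[ℂ] Matrix κ κ ℂ}

/-- Kraus strings that are typical for the spectrum of the Choi state feed the one-shot bound. -/
lemma exists_le_avgContraction_tensorPower (hτ : (choiState T).PosSemidef)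
    (htr : ∀ X, (T X).trace = X.trace) {ε δ : ℝ} (hε : 0 < ε) (hδ : 0 < δ) :
    ∃ N : ℕ, ∀ n, N ≤ n → ∀ μ : Measure (PureState (Fin n → ι)),
      IsProbabilityMeasure μ → NullSingletonClass μ → IsStateDesign 1 μ →
      1 - ε - ((2 : ℝ) ^ (vonNeumannEntropy (choiState T) + δ) * opNorm (T (maxMixed ι))) ^ n ≤
        avgContraction (tensorPower T n) (μ.prod μ) := by
  obtain ⟨K, hK, hKtr⟩ := exists_kraus_of_choiState T hτ
  have hp1 : ∑ s, hτ.1.eigenvalues s = 1 := by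
    have h := hτ.1.trace_eq_sum_eigenvalues
    rw [trace_choiState htr] at h
    have h' := congrArg Complex.re h
    rw [Complex.re_sum] at h'
    exact h'.symm
  obtain ⟨N, hN⟩ := exists_typical_set hτ.1.eigenvalues hτ.eigenvalues_nonneg hp1 hδ hε
  refine ⟨N, fun n hn μ _ _ hμ => ?_⟩
  obtain ⟨A, hcard, hprob⟩ := hN n hn
  rw [← vonNeumannEntropy_eq_sum hτ.1] at hcard
  have hd : (Fintype.card ι : ℂ) ≠ 0 := by simp
  have hM : (T (maxMixed ι)).PosSemidef := by
    rw [hK]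
    refine posSemidef_sum_kraus _ K ?_
    rw [maxMixed, Matrix.smul_one_eq_diagonal]
    refine Matrix.PosSemidef.diagonal fun _ => ?_
    rw [Pi.zero_apply, inv_nonneg]
    exact Nat.cast_nonneg _
  have hc0 : 0 ≤ opNorm (T (maxMixed ι)) := norm_nonneg _
  have hc := posSemidef_opNorm_pow_sub hM n
  rw [← tensorPower_tensorProd T fun _ => maxMixed ι, ← maxMixed_pi] at hc
  have key := le_avgContraction (tensorPower_kraus hK) (trace_tensorPower htr) hμ A
    (pow_nonneg hc0 n) hc
  have hweight : (∑ s ∈ A, tensorProd (fun k => K (s k)) * maxMixed (Fin n → ι) *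
      (tensorProd fun k => K (s k))ᴴ).trace.re = ∑ s ∈ A, ∏ k, hτ.1.eigenvalues (s k) := by
    rw [Matrix.trace_sum, Complex.re_sum]
    refine Finset.sum_congr rfl fun s _ => ?_
    have h1 : ∀ s, (K s * maxMixed ι * (K s)ᴴ).trace = (hτ.1.eigenvalues s : ℂ) := fun s => by
      rw [maxMixed, Matrix.mul_smul, Matrix.mul_one, Matrix.smul_mul, Matrix.trace_smul, hKtr,
        smul_eq_mul, inv_mul_cancel_left₀ hd]
    rw [maxMixed_pi, conjTranspose_tensorProd, tensorProd_mul, tensorProd_mul, trace_tensorProd]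
    simp_rw [h1]
    rw [← Complex.ofReal_prod, Complex.ofReal_re]
  rw [hweight] at key
  have h2 := mul_le_mul_of_nonneg_right hcard (pow_nonneg hc0 n)
  rw [← mul_pow] at h2
  linarith

lemma avgContraction_tensorPower_le_one (hτ : (choiState T).PosSemidef)
    (htr : ∀ X, (T X).trace = X.trace) {n : ℕ}
    (ν : Measure (PureState (Fin n → ι) × PureState (Fin n → ι))) [IsProbabilityMeasure ν] :
    avgContraction (tensorPower T n) ν ≤ 1 := by
  obtain ⟨K, hK, -⟩ := exists_kraus_of_choiState T hτ
  refine avgContraction_le_one (fun X hX => ?_) (trace_tensorPower htr) ν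
  rw [tensorPower_kraus hK]
  exact posSemidef_sum_kraus _ _ hX

end Powers

lemma IsQuantumChannel.posSemidef_choiState {d d' : ℕ}
    {T : Matrix (Fin d) (Fin d) ℂ →ₗ[ℂ] Matrix (Fin d') (Fin d') ℂ} (hT : IsQuantumChannel T) :
    (choiState T).PosSemidef :=
  hT.completely_positive d _ (Matrix.posSemidef_vecMulVec_self_star _)

/-- There are no probability measures on the empty set of pure states of a zero-dimensional
space. -/
lemma pos_of_isProbabilityMeasure {d n : ℕ} (hn : 1 ≤ n)
    (μ : Measure (PureState (Fin n → Fin d))) [IsProbabilityMeasure μ] : 0 < d := by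
  obtain ⟨ρ⟩ := nonempty_of_isProbabilityMeasure μ
  by_contra h
  obtain rfl : d = 0 := by omega
  have : IsEmpty (Fin n → Fin 0) := ⟨fun f => (f ⟨0, hn⟩).elim0⟩
  have h1 := trace_pureState ρ
  simp [Matrix.trace] at h1

end QInfo

end

theorem mainTheorem1 (d d' : ℕ)
    (T : Matrix (Fin d) (Fin d) ℂ →ₗ[ℂ] Matrix (Fin d') (Fin d') ℂ)
    (hT : QInfo.IsQuantumChannel T) :
    (∀ ε : ℝ, 0 < ε → ε < 1 → ∀ δ : ℝ, 0 < δ →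
      ∃ N : ℕ, ∀ n : ℕ, N ≤ n →
        ∀ μ : MeasureTheory.Measure (QInfo.PureState (Fin n → Fin d)),
          MeasureTheory.IsProbabilityMeasure μ → MeasureTheory.NullSingletonClass μ →
          QInfo.IsStateDesign 1 μ →
          1 - ε - ((2 : ℝ) ^ (QInfo.vonNeumannEntropy (QInfo.choiState T) + δ) *
              QInfo.opNorm (T (QInfo.maxMixed (Fin d)))) ^ n ≤
            QInfo.avgContraction (QInfo.tensorPower T n) (μ.prod μ)) ∧
    (QInfo.vonNeumannEntropy (QInfo.choiState T) <
        Real.logb 2 (1 / QInfo.opNorm (T (QInfo.maxMixed (Fin d)))) →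
      ∀ ε : ℝ, 0 < ε →
        ∃ N : ℕ, ∀ n : ℕ, N ≤ n →
          ∀ μ : MeasureTheory.Measure (QInfo.PureState (Fin n → Fin d)),
            MeasureTheory.IsProbabilityMeasure μ → MeasureTheory.NullSingletonClass μ →
            QInfo.IsStateDesign 1 μ →
            |QInfo.avgContraction (QInfo.tensorPower T n) (μ.prod μ) - 1| < ε) := by
  rcases Nat.eq_zero_or_pos d with rfl | hd
  · exact ⟨fun ε _ _ δ _ => ⟨1, fun n hn μ _ _ _ =>
        absurd (QInfo.pos_of_isProbabilityMeasure hn μ) (lt_irrefl 0)⟩,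
      fun _ ε _ => ⟨1, fun n hn μ _ _ _ =>
        absurd (QInfo.pos_of_isProbabilityMeasure hn μ) (lt_irrefl 0)⟩⟩
  have : Nonempty (Fin d) := ⟨⟨0, hd⟩⟩
  have hτ := hT.posSemidef_choiState
  have htr := hT.trace_preserving
  refine ⟨fun ε hε _ δ hδ => QInfo.exists_le_avgContraction_tensorPower hτ htr hε hδ,
    fun hS ε hε => ?_⟩
  set s := QInfo.vonNeumannEntropy (QInfo.choiState T) with hs
  set c := QInfo.opNorm (T (QInfo.maxMixed (Fin d))) with hc
  have hc0 : 0 ≤ c := norm_nonneg _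
  -- Half of the gap between the entropy and `-log c` is spent as `δ`.
  obtain ⟨δ, hδ, hlt⟩ : ∃ δ, 0 < δ ∧ (2 : ℝ) ^ (s + δ) * c < 1 := by
    refine ⟨(Real.logb 2 (1 / c) - s) / 2, by linarith, ?_⟩
    -- For `c = 0`, where `1 / c` is a junk value, the product vanishes.
    rcases hc0.eq_or_lt with h | h
    · rw [← h, mul_zero]; exact one_pos
    · have h1 : (2 : ℝ) ^ (s + (Real.logb 2 (1 / c) - s) / 2) < 1 / c := by
        rw [← Real.lt_logb_iff_rpow_lt one_lt_two (by positivity)]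
        linarith
      exact (lt_div_iff₀ h).1 h1
  obtain ⟨N₁, hN₁⟩ := QInfo.exists_le_avgContraction_tensorPower hτ htr (half_pos hε) hδ
  obtain ⟨N₂, hN₂⟩ := exists_pow_lt_of_lt_one (half_pos hε) hlt
  refine ⟨max N₁ N₂, fun n hn μ hμ hμ' hdes => ?_⟩
  have h1 := hN₁ n (le_of_max_le_left hn) μ hμ hμ' hdes
  have h2 := QInfo.avgContraction_tensorPower_le_one hτ htr (μ.prod μ)
  have h3 := pow_le_pow_of_le_one (mul_nonneg (Real.rpow_nonneg two_pos.le _) hc0) hlt.le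
    (le_of_max_le_right hn)
  rw [abs_lt]
  constructor <;> linarith
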